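/- Let $(R,\mathfrak m)$ be a one-dimensional Noetherian local domain with infinite residue field $k$ and quotient field $K$. Assume that the integral closure $\overline R$ of $R$ in $K$ is a finite $R$-module and a discrete valuation ring, and that $R$ is residually rational, i.e. the natural map from $k$ to the residue field of $\overline R$ is an isomorphism. Write $\ell$ for the length of $R$-modules and $A:B=\{y\in K : yB\subseteq A\}$ for $R$-submodules $A,B$ of $K$. Let - $h(z)\in\mathbb Z[z]$ be the polynomial with $\sum_{n\ge 0}\ell(\mathfrak m^n/\mathfrak m^{n+1})z^n=h(z)/(1-z)$, and $e=h(1)$ the multiplicity of $R$; - $\mu=\ell(\mathfrak m/\mathfrak m^2)$ be the embedding dimension of $R$, and $r=\ell((R:\mathfrak m)/R)$ its Cohen–Macaulay type; - $\Lambda=\bigcup_{n\ge 0}(\mathfrak m^n:\mathfrak m^n)$ be the blowing-up of $R$ along $\mathfrak m$; - $x\in\mathfrak m$ be a minimal reduction of $\mathfrak m$, i.e. $\mathfrak m^{n+1}=x\mathfrak m^n$ for all $n\gg 0$, and $\nu$ the reduction exponent, i.e. the least integer such that $\mathfrak m^{n+1}=x\mathfrak m^n$ for all $n\ge\nu$.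 Suppose that $e=\mu+1$. Then $\mathfrak m^\nu\subseteq R:\Lambda$ and $$\ell\big((R:\Lambda)/\mathfrak m^\nu\big)=r-1+(e-1)(\nu-2).$$ -/

import Mathlib

open IsLocalRing Polynomial

noncomputable section

namespace BlowUp

/-- The length `ℓ_R(A/B)` of the quotient of two submodules `B ⊆ A` of an `R`-module. -/
def lengthQuot {R M : Type*} [Ring R] [AddCommGroup M] [Module R M] (A B : Submodule R M) : ℕ∞ :=
  Module.length R (A ⧸ B.submoduleOf A)

section Ideals

variable {R : Type*} [CommRing R]

/-- The Hilbert function `H_I(n) = ℓ_R(I^n / I^(n+1))`. -/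
def hilbertFun (I : Ideal R) (n : ℕ) : ℕ :=
  (lengthQuot (I ^ n) (I ^ (n + 1))).toNat

/-- The Hilbert-Poincaré series `P_I(z) = ∑ H_I(n) z^n`. -/
def hilbertSeries (I : Ideal R) : PowerSeries ℤ :=
  PowerSeries.mk fun n => (hilbertFun I n : ℤ)

/-- `h` is the `h`-polynomial of `I`: `P_I(z) = h(z) / (1 - z)`. -/
def IsHPoly (I : Ideal R) (h : ℤ[X]) : Prop :=
  (1 - PowerSeries.X) * hilbertSeries I = (h : PowerSeries ℤ)

open Classical in
/-- The `h`-polynomial of `I` (it exists for primary ideals of the maximal ideal of a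
one-dimensional Noetherian local ring; the value is `0` if it does not exist). -/
def hPoly (I : Ideal R) : ℤ[X] :=
  if h : ∃ p : ℤ[X], IsHPoly I p then h.choose else 0

theorem IsHPoly.hPoly_eq {I : Ideal R} {p : ℤ[X]} (hp : IsHPoly I p) : hPoly I = p := by
  have h : ∃ p : ℤ[X], IsHPoly I p := ⟨p, hp⟩
  have h2 : hPoly I = h.choose := dif_pos h
  rw [h2]
  exact Polynomial.coe_injective ℤ (h.choose_spec.symm.trans hp)

/-- The multiplicity `e(I) = h_I(1)`. -/
def multiplicity (I : Ideal R) : ℤ := (hPoly I).eval 1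

/-- `x` is a minimal reduction of `I`: `x ∈ I` and `I^(n+1) = x I^n` for `n ≫ 0`. -/
def IsMinimalReduction (I : Ideal R) (x : R) : Prop :=
  x ∈ I ∧ ∃ N : ℕ, ∀ n ≥ N, I ^ (n + 1) = Ideal.span {x} * I ^ n

/-- The reduction exponent of `I` with respect to a minimal reduction `x`:
the least `ν` such that `I^(n+1) = x I^n` for all `n ≥ ν`. -/
def reductionExponent (I : Ideal R) (x : R) : ℕ :=
  sInf {N : ℕ | ∀ n ≥ N, I ^ (n + 1) = Ideal.span {x} * I ^ n}

variable (R) in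
/-- The embedding dimension `μ = ℓ_R(m / m^2)` of a local ring. -/
def embDim [IsLocalRing R] : ℕ :=
  (lengthQuot (maximalIdeal R) (maximalIdeal R ^ 2)).toNat

end Ideals

section Fractional

variable {R : Type*} [CommRing R] (K : Type*) [Field K] [Algebra R K]

/-- An ideal of `R` seen inside `K`. -/
abbrev inK (I : Ideal R) : Submodule R K := IsLocalization.coeSubmodule K I

theorem colon_mono (I : Ideal R) :
    Monotone fun n : ℕ => inK K (I ^ n) / inK K (I ^ n) := by
  refine monotone_nat_of_le_succ fun n => ?_
  have h : inK K (I ^ (n + 1)) = inK K (I ^ n) * inK K I := by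
    rw [pow_succ, inK, IsLocalization.coeSubmodule_mul]
  rw [Submodule.le_div_iff_mul_le, h, ← mul_assoc]
  exact mul_le_mul_left (Submodule.le_div_iff_mul_le.mp le_rfl) _

/-- The blowing-up `Λ(I) = ⋃ₙ (I^n : I^n)` of `R` along `I`, as an `R`-submodule of `K`.
For submodules of `K`, `A / B` is the colon `{y ∈ K | y B ⊆ A}`. -/
def blowUp (I : Ideal R) : Submodule R K where
  carrier := ⋃ n : ℕ, ((inK K (I ^ n) / inK K (I ^ n) : Submodule R K) : Set K)
  add_mem' := by
    intro a b ha hb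
    simp only [Set.mem_iUnion, SetLike.mem_coe] at ha hb ⊢
    obtain ⟨i, hi⟩ := ha
    obtain ⟨j, hj⟩ := hb
    exact ⟨max i j, add_mem (colon_mono K I (le_max_left i j) hi)
      (colon_mono K I (le_max_right i j) hj)⟩
  zero_mem' := Set.mem_iUnion.mpr ⟨0, zero_mem _⟩
  smul_mem' := by
    intro c a ha
    simp only [Set.mem_iUnion, SetLike.mem_coe] at ha ⊢
    obtain ⟨i, hi⟩ := ha
    exact ⟨i, Submodule.smul_mem _ c hi⟩

variable (R) in
/-- The Cohen-Macaulay type `r = ℓ_R((R : m) / R)` of a one-dimensional local domain `R`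
with quotient field `K`; here `1` is `R` as a submodule of `K`. -/
def cmType [IsLocalRing R] : ℕ :=
  (lengthQuot ((1 : Submodule R K) / inK K (maximalIdeal R)) 1).toNat

end Fractional

end BlowUp

end

/-!
By additivity of length, `e = ℓ(R/xR) = ℓ(𝔪ⁿ⁺¹/x𝔪ⁿ) + ℓ(𝔪ⁿ/𝔪ⁿ⁺¹)` for all `n`, so `e = μ + 1` means
that `𝔪²/x𝔪` has length one. It is then generated by the class of a single product `ab` with
`a, b ∈ 𝔪`, and `𝔪ⁿ⁺²/x𝔪ⁿ⁺¹` is generated by the class of `aⁿ⁺¹b`, so it has length one as long as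
`n + 1 < ν`. The Hilbert function is thus `1, e - 1, …, e - 1` up to degree `ν - 1`, which gives
`ℓ(R/𝔪^ν)`.

Since `Λ = x^{-ν}𝔪^ν`, the conductor `R : Λ` is the ideal of all `y` with `y𝔪^ν ⊆ x^νR`. It lies in
`J = (xR : 𝔪)`, where `ℓ(J/xR) = r`. Choose `a, b` such that `ab ∉ x𝔪` has maximal order in the
valuation ring. Residual rationality forces `a` to have larger order than `x`, and therefore
multiplication by `ab` embeds `J/(R : Λ)` into `x𝔪²/x²𝔪`. As `x ∉ R : Λ`, the length of `J/(R : Λ)`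
is exactly one, and the formula follows by counting lengths.
-/

namespace BlowUp

section Length

variable {R M N : Type*} [Ring R] [AddCommGroup M] [Module R M] [AddCommGroup N] [Module R N]

theorem lengthQuot_top (B : Submodule R M) : lengthQuot ⊤ B = Module.length R (M ⧸ B) := by
  refine LinearEquiv.length_eq (Submodule.Quotient.equiv _ _ Submodule.topEquiv ?_)
  ext y
  simp [Submodule.submoduleOf]

theorem lengthQuot_eq_zero_iff {A B : Submodule R M} : lengthQuot A B = 0 ↔ A ≤ B := by
  rw [lengthQuot, Module.length_eq_zero_iff, Submodule.Quotient.subsingleton_iff,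
    Submodule.submoduleOf_eq_top]

theorem lengthQuot_eq_one_iff {A B : Submodule R M} (h : B ≤ A) : lengthQuot A B = 1 ↔ B ⋖ A := by
  rw [covBy_iff_quot_is_simple h, lengthQuot, Module.length_eq_one_iff]
  rfl

theorem lengthQuot_add {A B C : Submodule R M} (hCB : C ≤ B) (hBA : B ≤ A) :
    lengthQuot A C = lengthQuot B C + lengthQuot A B := by
  have hi : C.submoduleOf B = (C.submoduleOf A).comap (Submodule.inclusion hBA) := rfl
  have hp : C.submoduleOf A ≤ B.submoduleOf A := Submodule.comap_mono hCB
  refine Module.length_eq_add_of_exact (Submodule.mapQ _ _ (Submodule.inclusion hBA) hi.le)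
    (Submodule.factor hp) ?_ (Submodule.factor_surjective hp) ?_
  · rw [← LinearMap.ker_eq_bot, Submodule.ker_mapQ, ← hi, Submodule.mkQ_map_self]
  · rw [LinearMap.exact_iff, Submodule.range_mapQ, Submodule.factor, Submodule.ker_mapQ,
      Submodule.comap_id, Submodule.range_inclusion]
    rfl

theorem lengthQuot_le_of_le_map_sup (f : M →ₗ[R] N) {A B : Submodule R M} {A' B' : Submodule R N}
    (hA : A.map f ≤ A') (hB : B.map f ≤ B') (h : A' ≤ A.map f ⊔ B') :
    lengthQuot A' B' ≤ lengthQuot A B := by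
  let g : A →ₗ[R] A' := f.restrict (Submodule.map_le_iff_le_comap.1 hA)
  have hg : B.submoduleOf A ≤ (B'.submoduleOf A').comap g := fun y hy =>
    hB (Submodule.mem_map_of_mem hy)
  refine Module.length_le_of_surjective (Submodule.mapQ _ _ g hg) fun y => ?_
  obtain ⟨⟨y, hy⟩, rfl⟩ := Submodule.Quotient.mk_surjective _ y
  obtain ⟨_, ⟨z, hz, rfl⟩, w, hw, rfl⟩ := Submodule.mem_sup.1 (h hy)
  refine ⟨Submodule.Quotient.mk ⟨z, hz⟩, (Submodule.Quotient.eq _).2 ?_⟩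
  change f z - (f z + w) ∈ B'
  simpa using hw

theorem lengthQuot_le_of_comap_inf_le (f : M →ₗ[R] N) {A B : Submodule R M}
    {A' B' : Submodule R N} (hA : A.map f ≤ A') (h : B'.comap f ⊓ A ≤ B) :
    lengthQuot A B ≤ lengthQuot A' B' := by
  let g : A →ₗ[R] A' := f.restrict (Submodule.map_le_iff_le_comap.1 hA)
  let q : A →ₗ[R] A' ⧸ B'.submoduleOf A' := (B'.submoduleOf A').mkQ ∘ₗ g
  have hq : LinearMap.ker q ≤ B.submoduleOf A := fun y hy =>
    h ⟨(Submodule.Quotient.mk_eq_zero (B'.submoduleOf A') (x := g y)).1 hy, y.2⟩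
  calc lengthQuot A B
      ≤ Module.length R (A ⧸ LinearMap.ker q) :=
        Module.length_le_of_surjective _ (Submodule.factor_surjective hq)
    _ = Module.length R (LinearMap.range q) := q.quotKerEquivRange.length_eq
    _ ≤ lengthQuot A' B' :=
        Module.length_le_of_injective _ (LinearMap.range q).subtype_injective

theorem lengthQuot_map {f : M →ₗ[R] N} (hf : Function.Injective f) (A B : Submodule R M) :
    lengthQuot (A.map f) (B.map f) = lengthQuot A B :=
  le_antisymm (lengthQuot_le_of_le_map_sup f le_rfl le_rfl le_sup_left)
    (lengthQuot_le_of_comap_inf_le f le_rfl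
      (by rw [Submodule.comap_map_eq_of_injective hf]; exact inf_le_left))

end Length

section Regular

open nonZeroDivisors

variable {R : Type*} [CommRing R] {x : R}

theorem lengthQuot_span_mul (hx : x ∈ R⁰) (A B : Ideal R) :
    lengthQuot (Ideal.span {x} * A) (Ideal.span {x} * B) = lengthQuot A B := by
  have h (I : Ideal R) : Ideal.span {x} * I = Submodule.map (LinearMap.mulLeft R x) I := by
    ext y
    simp [Ideal.mem_span_singleton_mul]
  have hinj : Function.Injective (LinearMap.mulLeft R x) := fun _ _ hab =>
    (mul_cancel_left_mem_nonZeroDivisors hx).1 hab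
  rw [h, h, lengthQuot_map hinj]

theorem lengthQuot_self_span_mul (hx : x ∈ R⁰) {I : Ideal R} (hI : lengthQuot ⊤ I ≠ ⊤) :
    lengthQuot I (Ideal.span {x} * I) = lengthQuot ⊤ (Ideal.span {x}) := by
  refine ENat.add_left_injective_of_ne_top hI ?_
  calc lengthQuot I (Ideal.span {x} * I) + lengthQuot ⊤ I
      = lengthQuot ⊤ (Ideal.span {x} * I) := (lengthQuot_add Ideal.mul_le_right le_top).symm
    _ = lengthQuot (Ideal.span {x} * ⊤) (Ideal.span {x} * I) + lengthQuot ⊤ (Ideal.span {x}) := by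
        rw [Ideal.mul_top, ← lengthQuot_add Ideal.mul_le_left le_top]
    _ = lengthQuot ⊤ (Ideal.span {x}) + lengthQuot ⊤ I := by
        rw [lengthQuot_span_mul hx, add_comm]

variable [IsNoetherianRing R] [Ring.KrullDimLE 1 R]

theorem lengthQuot_ne_top (hx : x ∈ R⁰) (A : Ideal R) {B : Ideal R} (hxB : x ∈ B) :
    lengthQuot A B ≠ ⊤ := by
  refine ne_top_of_le_ne_top (b := lengthQuot ⊤ (Ideal.span {x})) ?_ ?_
  · rw [lengthQuot_top]
    exact Module.length_ne_top_iff.2 (isFiniteLength_quotient_span_singleton R hx)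
  · exact lengthQuot_le_of_comap_inf_le LinearMap.id le_top
      (inf_le_left.trans ((Ideal.span_singleton_le_iff_mem B).2 hxB))

end Regular

theorem multiplicity_eq_of_eventually_const {R : Type*} [CommRing R] {I : Ideal R} {c N : ℕ}
    (h : ∀ n ≥ N, hilbertFun I n = c) : multiplicity I = c := by
  let d : ℤ[X] := ∑ i ∈ Finset.range N, C ((hilbertFun I i : ℤ) - c) * X ^ i
  have hseries : hilbertSeries I = (d : PowerSeries ℤ) + PowerSeries.C (c : ℤ) *
      PowerSeries.mk 1 := by
    ext n
    simp only [d, hilbertSeries, PowerSeries.coeff_mk, map_add, Polynomial.coeff_coe,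
      PowerSeries.coeff_C_mul, Polynomial.finsetSum_coeff, Polynomial.coeff_C_mul_X_pow,
      Finset.sum_ite_eq, Finset.mem_range, Pi.one_apply, mul_one]
    split_ifs with hn
    · ring
    · rw [h n (not_lt.1 hn), zero_add]
  have hpoly : IsHPoly I ((1 - X) * d + C (c : ℤ)) := by
    rw [IsHPoly, hseries, mul_add, mul_left_comm, mul_comm _ (PowerSeries.mk 1),
      PowerSeries.mk_one_mul_one_sub_eq_one, mul_one]
    push_cast
    rfl
  rw [multiplicity, hpoly.hPoly_eq]
  simp

section Reduction

open nonZeroDivisors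

variable {R : Type*} [CommRing R] {I : Ideal R} {x : R}

theorem IsMinimalReduction.pow_succ_eq (hx : IsMinimalReduction I x) {n : ℕ}
    (hn : reductionExponent I x ≤ n) : I ^ (n + 1) = Ideal.span {x} * I ^ n :=
  Nat.sInf_mem (s := {N : ℕ | ∀ n ≥ N, I ^ (n + 1) = Ideal.span {x} * I ^ n}) hx.2 n hn

theorem reductionExponent_le {n : ℕ} (h : I ^ (n + 1) = Ideal.span {x} * I ^ n) :
    reductionExponent I x ≤ n := by
  refine Nat.sInf_le fun k hk => ?_
  induction k, hk using Nat.le_induction with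
  | base => exact h
  | succ k _ ih => rw [pow_succ, ih, mul_assoc, ← pow_succ, ih]

theorem IsMinimalReduction.pow_add_eq (hx : IsMinimalReduction I x) (k : ℕ) :
    I ^ (reductionExponent I x + k) = Ideal.span {x ^ k} * I ^ reductionExponent I x := by
  induction k with
  | zero => simp
  | succ k ih =>
    rw [← add_assoc, hx.pow_succ_eq (Nat.le_add_right _ _), ih, ← mul_assoc,
      Ideal.span_singleton_mul_span_singleton, ← pow_succ']

theorem span_mul_pow_le (hx : x ∈ I) (n : ℕ) : Ideal.span {x} * I ^ n ≤ I ^ (n + 1) := by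
  rw [pow_succ']
  exact Ideal.mul_mono_left ((Ideal.span_singleton_le_iff_mem I).2 hx)

theorem IsMinimalReduction.ne_zero [IsDomain R] (hx : IsMinimalReduction I x) (hI : I ≠ ⊥) :
    x ≠ 0 := by
  rintro rfl
  obtain ⟨N, hN⟩ := hx.2
  refine pow_ne_zero (N + 1) hI ?_
  rw [hN N le_rfl, Ideal.span_singleton_eq_bot.2 rfl, Ideal.bot_mul, Ideal.zero_eq_bot]

variable [IsNoetherianRing R] [Ring.KrullDimLE 1 R]

theorem lengthQuot_top_span_eq_add (hx0 : x ∈ R⁰) (hx : x ∈ I) (n : ℕ) :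
    lengthQuot ⊤ (Ideal.span {x}) =
      lengthQuot (I ^ (n + 1)) (Ideal.span {x} * I ^ n) + lengthQuot (I ^ n) (I ^ (n + 1)) := by
  rw [← lengthQuot_self_span_mul hx0
      (lengthQuot_ne_top (pow_mem hx0 n) ⊤ (Ideal.pow_mem_pow hx n)),
    lengthQuot_add (span_mul_pow_le hx n) (Ideal.pow_le_pow_right n.le_succ)]

theorem IsMinimalReduction.multiplicity_eq (hx : IsMinimalReduction I x) (hx0 : x ∈ R⁰) :
    multiplicity I = (lengthQuot ⊤ (Ideal.span {x})).toNat := by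
  refine multiplicity_eq_of_eventually_const (N := reductionExponent I x) fun n hn => ?_
  rw [hilbertFun, lengthQuot_top_span_eq_add hx0 hx.1 n, hx.pow_succ_eq hn,
    lengthQuot_eq_zero_iff.2 le_rfl, zero_add]

theorem IsMinimalReduction.lengthQuot_sq_eq_one (hx : IsMinimalReduction I x) (hx0 : x ∈ R⁰)
    (he : multiplicity I = hilbertFun I 1 + 1) : lengthQuot (I ^ 2) (Ideal.span {x} * I) = 1 := by
  have hsum := lengthQuot_top_span_eq_add hx0 hx.1 1
  have hfin := lengthQuot_ne_top hx0 ⊤ (Ideal.mem_span_singleton_self x)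
  rw [hx.multiplicity_eq hx0, hilbertFun] at he
  rw [pow_one, one_add_one_eq_two] at hsum he
  rw [hsum] at hfin he
  obtain ⟨hq, hp⟩ := WithTop.add_ne_top.1 hfin
  lift lengthQuot I (I ^ 2) to ℕ using hp with p
  lift lengthQuot (I ^ 2) (Ideal.span {x} * I) to ℕ using hq with q
  rw [← Nat.cast_add, ENat.toNat_natCast, ENat.toNat_natCast] at he
  norm_cast
  omega

end Reduction

section AlmostMinimalMultiplicity

open nonZeroDivisors

variable {R : Type*} [CommRing R] {I : Ideal R} {x a b : R}

theorem not_sq_le_of_lengthQuot_eq_one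
    (h1 : lengthQuot (I ^ 2) (Ideal.span {x} * I) = 1) : ¬ I ^ 2 ≤ Ideal.span {x} * I :=
  fun h => zero_ne_one ((lengthQuot_eq_zero_iff.2 h).symm.trans h1)

theorem exists_mul_notMem_of_not_sq_le {J : Ideal R} (h : ¬ I ^ 2 ≤ J) :
    ∃ a ∈ I, ∃ b ∈ I, a * b ∉ J := by
  rw [pow_two, Ideal.mul_le] at h
  push Not at h
  exact h

theorem mul_mem_sq (ha : a ∈ I) (hb : b ∈ I) : a * b ∈ I ^ 2 :=
  pow_two I ▸ Ideal.mul_mem_mul ha hb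

theorem sq_eq_sup_span_mul (h1 : lengthQuot (I ^ 2) (Ideal.span {x} * I) = 1) (hx : x ∈ I)
    (ha : a ∈ I) (hb : b ∈ I) (hab : a * b ∉ Ideal.span {x} * I) :
    I ^ 2 = Ideal.span {x} * I ⊔ Ideal.span {a} * Ideal.span {b} := by
  have hle : Ideal.span {x} * I ≤ I ^ 2 := by simpa using span_mul_pow_le hx 1
  have hcov := (lengthQuot_eq_one_iff hle).1 h1
  rw [Ideal.span_singleton_mul_span_singleton]
  refine ((hcov.eq_or_eq le_sup_left (sup_le hle
    ((Ideal.span_singleton_le_iff_mem _).2 (mul_mem_sq ha hb)))).resolve_left fun h => hab ?_).symm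
  exact h ▸ Ideal.mem_sup_right (Ideal.mem_span_singleton_self _)

theorem pow_eq_sup_pow_mul {X A B : Ideal R} (hX : X ≤ I) (hA : A ≤ I) (hB : B ≤ I)
    (h : I ^ 2 = X * I ⊔ A * B) (n : ℕ) : I ^ (n + 2) = X * I ^ (n + 1) ⊔ A ^ (n + 1) * B := by
  have hXI (k : ℕ) : X * I ^ k ≤ I ^ (k + 1) := pow_succ' I k ▸ Ideal.mul_mono_left hX
  have hAI (k : ℕ) : A ^ k * I ≤ I ^ (k + 1) :=
    pow_succ I k ▸ Ideal.mul_mono_left (Ideal.pow_right_mono hA k)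
  refine le_antisymm ?_ (sup_le (hXI _) ((Ideal.mul_mono_right hB).trans (hAI _)))
  induction n with
  | zero => simpa using h.le
  | succ n ih =>
    calc I ^ (n + 1 + 2) = I * I ^ (n + 2) := pow_succ' _ _
      _ ≤ I * (X * I ^ (n + 1) ⊔ A ^ (n + 1) * B) := Ideal.mul_mono_right ih
      _ = X * I ^ (n + 2) ⊔ A ^ (n + 1) * (I * B) := by rw [Ideal.mul_sup]; ring_nf
      _ ≤ X * I ^ (n + 2) ⊔ A ^ (n + 1) * I ^ 2 := by
        rw [pow_two]
        gcongr
      _ = X * I ^ (n + 2) ⊔ (X * (A ^ (n + 1) * I) ⊔ A ^ (n + 2) * B) := by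
        rw [h, Ideal.mul_sup]; ring_nf
      _ ≤ X * I ^ (n + 2) ⊔ A ^ (n + 2) * B :=
        sup_le le_sup_left (sup_le_sup_right (Ideal.mul_mono_right (hAI _)) _)

theorem pow_add_two_eq_sup (h1 : lengthQuot (I ^ 2) (Ideal.span {x} * I) = 1) (hx : x ∈ I)
    (ha : a ∈ I) (hb : b ∈ I) (hab : a * b ∉ Ideal.span {x} * I) (n : ℕ) :
    I ^ (n + 2) = Ideal.span {x} * I ^ (n + 1) ⊔ Ideal.span {a ^ (n + 1) * b} := by
  simp only [← Ideal.span_singleton_mul_span_singleton, ← Ideal.span_singleton_pow]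
  have hle {r : R} (hr : r ∈ I) : Ideal.span {r} ≤ I := (Ideal.span_singleton_le_iff_mem I).2 hr
  exact pow_eq_sup_pow_mul (hle hx) (hle ha) (hle hb) (sq_eq_sup_span_mul h1 hx ha hb hab) n

theorem lengthQuot_pow_le_one (h1 : lengthQuot (I ^ 2) (Ideal.span {x} * I) = 1) (hx : x ∈ I)
    (n : ℕ) : lengthQuot (I ^ (n + 2)) (Ideal.span {x} * I ^ (n + 1)) ≤ 1 := by
  obtain ⟨a, ha, b, hb, hab⟩ :=
    exists_mul_notMem_of_not_sq_le (not_sq_le_of_lengthQuot_eq_one h1)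
  have hmul {k : ℕ} : Submodule.map (LinearMap.mulLeft R (a ^ n)) (I ^ k) ≤ I ^ (n + k) := by
    rintro _ ⟨y, hy, rfl⟩
    exact pow_add I n k ▸ Ideal.mul_mem_mul (Ideal.pow_mem_pow ha n) hy
  rw [← h1]
  refine lengthQuot_le_of_le_map_sup (LinearMap.mulLeft R (a ^ n)) hmul ?_ ?_
  · rintro _ ⟨_, hy, rfl⟩
    obtain ⟨z, hz, rfl⟩ := Ideal.mem_span_singleton_mul.1 hy
    refine Ideal.mem_span_singleton_mul.2 ⟨a ^ n * z, ?_, mul_left_comm _ _ _⟩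
    exact hmul (k := 1) (Submodule.mem_map_of_mem (by rwa [pow_one]))
  · rw [pow_add_two_eq_sup h1 hx ha hb hab n]
    refine sup_le le_sup_right (le_sup_of_le_left ?_)
    rw [Ideal.span_singleton_le_iff_mem]
    exact ⟨a * b, mul_mem_sq ha hb, by simp only [LinearMap.mulLeft_apply]; ring⟩

theorem lengthQuot_pow_eq_one (h1 : lengthQuot (I ^ 2) (Ideal.span {x} * I) = 1) (hx : x ∈ I)
    {n : ℕ} (hn : n + 1 < reductionExponent I x) :
    lengthQuot (I ^ (n + 2)) (Ideal.span {x} * I ^ (n + 1)) = 1 := by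
  refine le_antisymm (lengthQuot_pow_le_one h1 hx n) (Order.one_le_iff_ne_zero.2 fun h => ?_)
  exact hn.not_ge (reductionExponent_le
    (le_antisymm (lengthQuot_eq_zero_iff.1 h) (span_mul_pow_le hx _)))

theorem IsMinimalReduction.two_le_reductionExponent (hx : IsMinimalReduction I x)
    (h : ¬ I ^ 2 ≤ Ideal.span {x} * I) : 2 ≤ reductionExponent I x := by
  by_contra! hlt
  exact h (by simpa using (hx.pow_succ_eq (Nat.lt_succ_iff.1 hlt)).le)

theorem lengthQuot_top_pow [IsNoetherianRing R] [Ring.KrullDimLE 1 R]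
    (h1 : lengthQuot (I ^ 2) (Ideal.span {x} * I) = 1) (hx0 : x ∈ R⁰) (hx : x ∈ I) {n : ℕ}
    (hn : n + 1 ≤ reductionExponent I x) :
    lengthQuot ⊤ (I ^ (n + 1)) + n = lengthQuot ⊤ I + n * lengthQuot ⊤ (Ideal.span {x}) := by
  induction n with
  | zero => simp
  | succ n ih =>
    have hstep := lengthQuot_top_span_eq_add hx0 hx (n + 1)
    rw [lengthQuot_pow_eq_one h1 hx hn] at hstep
    rw [lengthQuot_add (Ideal.pow_le_pow_right (n + 1).le_succ) le_top]
    push_cast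
    calc lengthQuot (I ^ (n + 1)) (I ^ (n + 1 + 1)) + lengthQuot ⊤ (I ^ (n + 1)) + (n + 1)
        = (lengthQuot ⊤ (I ^ (n + 1)) + n) +
            (1 + lengthQuot (I ^ (n + 1)) (I ^ (n + 1 + 1))) := by ring
      _ = lengthQuot ⊤ I + (n + 1) * lengthQuot ⊤ (Ideal.span {x}) := by
        rw [ih (Nat.le_of_succ_le hn), ← hstep]
        ring

end AlmostMinimalMultiplicity

section Order

variable {R : Type*} (V : Type*) [CommRing R] [CommRing V] [IsDomain V]
  [IsDiscreteValuationRing V] [Algebra R V]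

/-- The order of an element of `R` in a discrete valuation ring `V` over `R`, with `ord V 0 = ⊤`. -/
noncomputable def ord : AddValuation R ℕ∞ :=
  (IsDiscreteValuationRing.addVal V).comap (algebraMap R V)

variable {V}

theorem ord_apply (r : R) : ord V r = IsDiscreteValuationRing.addVal V (algebraMap R V r) := rfl

theorem ord_le_ord_iff {r s : R} : ord V r ≤ ord V s ↔ algebraMap R V r ∣ algebraMap R V s := by
  rw [ord_apply, ord_apply, IsDiscreteValuationRing.addVal_le_iff_dvd]

variable [FaithfulSMul R V]

theorem ord_ne_top {r : R} (hr : r ≠ 0) : ord V r ≠ ⊤ := by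
  rw [ord_apply, Ne, IsDiscreteValuationRing.addVal_eq_top_iff]
  simpa using hr

theorem IsMinimalReduction.ord_le [IsDomain R] {I : Ideal R} (hI : I ≠ ⊥) {x : R}
    (hx : IsMinimalReduction I x) {y : R} (hy : y ∈ I) : ord V x ≤ ord V y := by
  obtain ⟨N, hN⟩ := hx.2
  obtain ⟨t, ht, hmin⟩ :=
    exists_minimalFor_of_wellFoundedLT (· ∈ I ^ N) (ord V) ⟨0, (I ^ N).zero_mem⟩
  have hmin' {s : R} (hs : s ∈ I ^ N) : ord V t ≤ ord V s := (le_total _ _).elim id (hmin hs)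
  obtain ⟨u, hu, hu0⟩ := Submodule.exists_mem_ne_zero_of_ne_bot (pow_ne_zero N hI)
  have htop : ord V t ≠ ⊤ := ne_top_of_le_ne_top (ord_ne_top hu0) (hmin' hu)
  have hyt : y * t ∈ Ideal.span {x} * I ^ N := hN N le_rfl ▸ pow_succ' I N ▸ Ideal.mul_mem_mul hy ht
  obtain ⟨s, hs, hst⟩ := Ideal.mem_span_singleton_mul.1 hyt
  refine (ENat.add_le_add_iff_right htop).1 ?_
  calc ord V x + ord V t ≤ ord V x + ord V s := by gcongr; exact hmin' hs
    _ = ord V y + ord V t := by rw [← (ord V).map_mul, hst, (ord V).map_mul]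

theorem exists_lt_ord_sub_mul
    (hres : Function.Surjective ((residue V).comp (algebraMap R V)))
    {x y : R} (hx : x ≠ 0) (h : ord V x ≤ ord V y) : ∃ u : R, ord V x < ord V (y - u * x) := by
  obtain ⟨c, hc⟩ := ord_le_ord_iff.1 h
  obtain ⟨u, hu⟩ := hres (residue V c)
  have hcu : c - algebraMap R V u ∈ maximalIdeal V := by
    rw [← residue_eq_zero_iff, map_sub, ← hu]
    exact sub_self _
  have hpos : IsDiscreteValuationRing.addVal V (c - algebraMap R V u) ≠ 0 :=
    mt IsDiscreteValuationRing.addVal_eq_zero_iff.1 hcu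
  have heq : ord V (y - u * x) =
      IsDiscreteValuationRing.addVal V (c - algebraMap R V u) + ord V x := by
    rw [ord_apply, ord_apply, ← IsDiscreteValuationRing.addVal_mul, map_sub, map_mul, hc]
    ring_nf
  exact ⟨u, heq ▸ ENat.lt_add_left (ord_ne_top hx) (pos_iff_ne_zero.2 hpos)⟩

variable [IsDomain R]

theorem exists_forall_mem_of_le_ord
    (hV : ∃ f : R, f ≠ 0 ∧ ∀ v : V, ∃ r : R, algebraMap R V r = f • v)
    {J : Ideal R} (hJ : J ≠ ⊥) : ∃ N : ℕ, ∀ r : R, N ≤ ord V r → r ∈ J := by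
  obtain ⟨f, hf0, hf⟩ := hV
  obtain ⟨y, hy, hy0⟩ := Submodule.exists_mem_ne_zero_of_ne_bot hJ
  refine ⟨(ord V (y * f)).toNat, fun r hr => ?_⟩
  rw [ENat.natCast_toNat (ord_ne_top (mul_ne_zero hy0 hf0)), ord_le_ord_iff] at hr
  obtain ⟨v, hv⟩ := hr
  obtain ⟨s, hs⟩ := hf v
  have hrs : r = y * s := by
    refine FaithfulSMul.algebraMap_injective R V ?_
    rw [hv, map_mul, map_mul, hs, Algebra.smul_def, mul_assoc]
  exact hrs ▸ J.mul_mem_right s hy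

theorem exists_maximalFor_ord
    (hV : ∃ f : R, f ≠ 0 ∧ ∀ v : V, ∃ r : R, algebraMap R V r = f • v)
    {J : Ideal R} (hJ : J ≠ ⊥) {ι : Type*} {s : Set ι} (hs : s.Nonempty) {g : ι → R}
    (hg : ∀ i ∈ s, g i ∉ J) : ∃ i, MaximalFor (· ∈ s) (fun i => ord V (g i)) i := by
  obtain ⟨N, hN⟩ := exists_forall_mem_of_le_ord hV hJ
  refine Set.Finite.exists_maximalFor' _ s (((Set.finite_Iio N).image ((↑) : ℕ → ℕ∞)).subset ?_) hs
  rintro _ ⟨i, hi, rfl⟩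
  have hlt : ord V (g i) < N := not_le.1 (mt (hN _) (hg i hi))
  lift ord V (g i) to ℕ using hlt.ne_top with m
  exact ⟨m, Nat.cast_lt.1 hlt, rfl⟩

end Order

section ExtremalPair

variable {R V : Type*} [CommRing R] [CommRing V] [IsDomain V] [IsDiscreteValuationRing V]
  [Algebra R V] {I : Ideal R} {x a b : R}

variable (V) in
/-- A pair `a, b ∈ I` with `a b ∉ x I` that is extremal for the order in `V`: `a` has larger order
than `x`, and `b` cannot be replaced by an element of `I` of larger order. -/
structure IsExtremalPair (I : Ideal R) (x a b : R) : Prop where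
  left_mem : a ∈ I
  right_mem : b ∈ I
  mul_notMem : a * b ∉ Ideal.span {x} * I
  ord_lt : ord V x < ord V a
  mul_mem : ∀ z ∈ I, ord V b < ord V z → a * z ∈ Ideal.span {x} * I

variable [FaithfulSMul R V]

theorem exists_isExtremalPair [IsDomain R]
    (hV : ∃ f : R, f ≠ 0 ∧ ∀ v : V, ∃ r : R, algebraMap R V r = f • v)
    (hres : Function.Surjective ((residue V).comp (algebraMap R V)))
    (hI : I ≠ ⊥) (hx : IsMinimalReduction I x) (hne : ¬ I ^ 2 ≤ Ideal.span {x} * I) :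
    ∃ a b, IsExtremalPair V I x a b := by
  set J := Ideal.span {x} * I
  have hx0 := hx.ne_zero hI
  have hJ0 : J ≠ ⊥ := mul_ne_zero (mt Ideal.span_singleton_eq_bot.1 hx0) hI
  let s : Set (R × R) := {p | p.1 ∈ I ∧ p.2 ∈ I ∧ p.1 * p.2 ∉ J}
  obtain ⟨a₀, ha₀, b₀, hb₀, hab₀⟩ := exists_mul_notMem_of_not_sq_le hne
  obtain ⟨⟨a, b⟩, ⟨ha, hb, hab⟩, hmax⟩ :=
    exists_maximalFor_ord hV hJ0 (s := s) (g := fun p => p.1 * p.2) ⟨(a₀, b₀), ha₀, hb₀, hab₀⟩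
      fun p hp => hp.2.2
  have hmem {a' b' : R} (ha' : a' ∈ I) (hb' : b' ∈ I) (hlt : ord V (a * b) < ord V (a' * b')) :
      a' * b' ∈ J := by
    by_contra hab'
    exact hlt.not_ge (hmax (j := (a', b')) ⟨ha', hb', hab'⟩ hlt.le)
  have ha0 : ord V a ≠ ⊤ := ord_ne_top fun h => hab (by simp [h])
  have hb0 : ord V b ≠ ⊤ := ord_ne_top fun h => hab (by simp [h])
  refine ⟨a, b, ha, hb, hab, (hx.ord_le hI ha).lt_of_ne fun heq => hab ?_, fun z hz hlt => ?_⟩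
  · -- if `a` and `x` have the same order, subtracting a multiple of `x` from `a` raises the order
    obtain ⟨u, hu⟩ := exists_lt_ord_sub_mul hres hx0 heq.le
    have hsub : (a - u * x) * b ∈ J := hmem (sub_mem ha (Ideal.mul_mem_left _ _ hx.1)) hb <| by
      rw [(ord V).map_mul, (ord V).map_mul, ← heq]
      exact (ENat.add_lt_add_iff_right hb0).2 hu
    have hxub : x * (u * b) ∈ J :=
      Ideal.mul_mem_mul (Ideal.mem_span_singleton_self x) (Ideal.mul_mem_left _ _ hb)
    convert add_mem hsub hxub using 1
    ring
  · refine hmem ha hz ?_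
    rw [(ord V).map_mul, (ord V).map_mul]
    exact (ENat.add_lt_add_iff_left ha0).2 hlt

theorem IsExtremalPair.pow_dvd_pow_mul (h : IsExtremalPair V I x a b) (hx0 : x ≠ 0) (n : ℕ)
    {z : R} (hz : z ∈ I) (hbz : ord V b < ord V z) : x ^ n ∣ a ^ n * z := by
  induction n generalizing z with
  | zero => simp
  | succ n ih =>
    obtain ⟨w, hw, hwz⟩ := Ideal.mem_span_singleton_mul.1 (h.mul_mem z hz hbz)
    have hzw : ord V z ≤ ord V w := by
      rw [← ENat.add_le_add_iff_left (ord_ne_top (V := V) hx0), ← (ord V).map_mul x w, hwz,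
        (ord V).map_mul]
      gcongr
      exact h.ord_lt.le
    calc x ^ (n + 1) = x * x ^ n := pow_succ' x n
      _ ∣ x * (a ^ n * w) := mul_dvd_mul_left x (ih hw (hbz.trans_le hzw))
      _ = a ^ (n + 1) * z := by rw [mul_left_comm, hwz, pow_succ, mul_assoc]

theorem IsExtremalPair.ord_lt_of_mul_eq (h : IsExtremalPair V I x a b) (hx0 : x ≠ 0) {y z : R}
    (hxy : ord V x ≤ ord V y) (hyz : y * (a * b) = x ^ 2 * z) : ord V b < ord V z := by
  have hxt : ord V x ≠ ⊤ := ord_ne_top hx0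
  have hb0 : ord V b ≠ ⊤ := ord_ne_top fun hb => h.mul_notMem (by simp [hb])
  refine (ENat.add_lt_add_iff_left (WithTop.add_ne_top.2 ⟨hxt, hxt⟩)).1 ?_
  calc ord V x + ord V x + ord V b < ord V y + ord V a + ord V b :=
        (ENat.add_lt_add_iff_right hb0).2 (ENat.add_lt_add_of_le_of_lt hxt hxy h.ord_lt)
    _ = ord V x + ord V x + ord V z := by
        simp only [← (ord V).map_mul, mul_assoc, hyz, pow_two]

end ExtremalPair

section Colon

variable {R : Type*} [CommRing R] {I : Ideal R} {x : R} {n : ℕ}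

/-- The ideal of all `y` with `y I^n ⊆ x^n R`; inside the quotient field of a domain `R` this is
`R : x⁻ⁿ Iⁿ` when `x ∈ I` is nonzero. -/
def colonPow (I : Ideal R) (x : R) (n : ℕ) : Ideal R :=
  (Ideal.span {x ^ n}).colon ((I ^ n : Ideal R) : Set R)

theorem mem_colonPow {y : R} : y ∈ colonPow I x n ↔ ∀ t ∈ I ^ n, x ^ n ∣ y * t := by
  simp [colonPow, Submodule.mem_colon, Ideal.mem_span_singleton]

theorem mem_colonPow_one {y : R} : y ∈ colonPow I x 1 ↔ ∀ t ∈ I, x ∣ y * t := by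
  rw [mem_colonPow, pow_one, pow_one]

theorem span_le_colonPow_one (I : Ideal R) (x : R) : Ideal.span {x} ≤ colonPow I x 1 := by
  rw [Ideal.span_singleton_le_iff_mem, mem_colonPow_one]
  exact fun t _ => dvd_mul_right x t

theorem IsMinimalReduction.pow_le_colonPow (hx : IsMinimalReduction I x) :
    I ^ reductionExponent I x ≤ colonPow I x (reductionExponent I x) := by
  intro y hy
  refine mem_colonPow.2 fun t ht => ?_
  have h := Ideal.mul_mem_mul hy ht
  rw [← pow_add, hx.pow_add_eq] at h
  exact Ideal.mem_span_singleton.1 (Ideal.mul_le_left h)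

theorem colonPow_le_colonPow_one [IsDomain R] (hx : x ∈ I) (hx0 : x ≠ 0) (n : ℕ) :
    colonPow I x (n + 1) ≤ colonPow I x 1 := by
  intro y hy
  refine mem_colonPow_one.2 fun t ht => ?_
  have hmem : x ^ n * t ∈ I ^ (n + 1) :=
    pow_succ I n ▸ Ideal.mul_mem_mul (Ideal.pow_mem_pow hx n) ht
  have hdvd := mem_colonPow.1 hy _ hmem
  rwa [pow_succ, mul_left_comm, mul_dvd_mul_iff_left (pow_ne_zero n hx0)] at hdvd

variable {V : Type*} [CommRing V] [IsDomain V] [IsDiscreteValuationRing V] [Algebra R V]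
  [FaithfulSMul R V] {a b : R}

theorem IsExtremalPair.mem_colonPow (h : IsExtremalPair V I x a b)
    (h1 : lengthQuot (I ^ 2) (Ideal.span {x} * I) = 1) (hx : x ∈ I) (hx0 : x ≠ 0) {y z : R}
    (hy : y ∈ colonPow I x 1) (hxy : ord V x ≤ ord V y) (hz : z ∈ I)
    (hyz : y * (a * b) = x ^ 2 * z) (n : ℕ) : y ∈ colonPow I x (n + 1) := by
  induction n with
  | zero => exact hy
  | succ n ih =>
    rw [BlowUp.mem_colonPow] at ih ⊢
    intro t ht
    rw [pow_add_two_eq_sup h1 hx h.left_mem h.right_mem h.mul_notMem] at ht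
    obtain ⟨_, hs, _, hr, rfl⟩ := Submodule.mem_sup.1 ht
    obtain ⟨s, hsI, rfl⟩ := Ideal.mem_span_singleton_mul.1 hs
    obtain ⟨c, rfl⟩ := Ideal.mem_span_singleton'.1 hr
    rw [mul_add]
    refine dvd_add ?_ ?_
    · rw [mul_left_comm, pow_succ']
      exact mul_dvd_mul_left x (ih s hsI)
    · have hyab : y * (a ^ (n + 1) * b) = x ^ 2 * (a ^ n * z) := by
        linear_combination a ^ n * hyz
      rw [mul_left_comm, hyab, add_assoc, one_add_one_eq_two, pow_add, mul_comm (x ^ n)]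
      have hdvd := h.pow_dvd_pow_mul hx0 n hz (h.ord_lt_of_mul_eq hx0 hxy hyz)
      exact (mul_dvd_mul_left _ hdvd).mul_left c

end Colon

section Local

variable {R : Type*} [CommRing R] [IsDomain R] [IsLocalRing R] [IsNoetherianRing R] {x : R}

theorem IsMinimalReduction.notMem_sq (hx : IsMinimalReduction (maximalIdeal R) x)
    (hm : maximalIdeal R ≠ ⊥) : x ∉ maximalIdeal R ^ 2 := by
  intro hx2
  obtain ⟨N, hN⟩ := hx.2
  have hle : maximalIdeal R ^ (N + 1) ≤ maximalIdeal R • maximalIdeal R ^ (N + 1) :=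
    calc maximalIdeal R ^ (N + 1) = Ideal.span {x} * maximalIdeal R ^ N := hN N le_rfl
      _ ≤ maximalIdeal R ^ 2 * maximalIdeal R ^ N :=
        Ideal.mul_mono_left ((Ideal.span_singleton_le_iff_mem _).2 hx2)
      _ = maximalIdeal R • maximalIdeal R ^ (N + 1) := by rw [smul_eq_mul]; ring
  exact pow_ne_zero (N + 1) hm (Submodule.eq_bot_of_le_smul_of_le_jacobson_bot _ _
    (IsNoetherian.noetherian _) hle (maximalIdeal_le_jacobson _))

theorem IsMinimalReduction.sq_inf_span_le (hx : IsMinimalReduction (maximalIdeal R) x)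
    (hm : maximalIdeal R ≠ ⊥) :
    maximalIdeal R ^ 2 ⊓ Ideal.span {x} ≤ Ideal.span {x} * maximalIdeal R := by
  rintro _ ⟨hy2, hyx⟩
  obtain ⟨s, rfl⟩ := Ideal.mem_span_singleton.1 hyx
  refine Ideal.mul_mem_mul (Ideal.mem_span_singleton_self x) ?_
  by_contra hs
  exact hx.notMem_sq hm ((Ideal.mul_unit_mem_iff_mem _ (notMem_maximalIdeal.1 hs)).1 hy2)

theorem IsMinimalReduction.colonPow_one_le (hx : IsMinimalReduction (maximalIdeal R) x)
    (hm : maximalIdeal R ≠ ⊥)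
    (hne : ¬ maximalIdeal R ^ 2 ≤ Ideal.span {x} * maximalIdeal R) :
    colonPow (maximalIdeal R) x 1 ≤ maximalIdeal R := by
  intro y hy
  by_contra hyu
  have hmx : maximalIdeal R ≤ Ideal.span {x} := fun t ht =>
    Ideal.mem_span_singleton.2 <|
      (notMem_maximalIdeal.1 hyu).dvd_mul_left.1 (mem_colonPow_one.1 hy t ht)
  exact hne ((le_inf le_rfl ((Ideal.pow_le_self two_ne_zero).trans hmx)).trans
    (hx.sq_inf_span_le hm))

theorem IsMinimalReduction.notMem_colonPow (hx : IsMinimalReduction (maximalIdeal R) x)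
    (hm : maximalIdeal R ≠ ⊥)
    (hne : ¬ maximalIdeal R ^ 2 ≤ Ideal.span {x} * maximalIdeal R) (n : ℕ) :
    x ∉ colonPow (maximalIdeal R) x (n + 2) := by
  intro h
  refine hne ((le_inf le_rfl fun t ht => ?_).trans (hx.sq_inf_span_le hm))
  have hmem : x ^ n * t ∈ maximalIdeal R ^ (n + 2) :=
    pow_add (maximalIdeal R) n 2 ▸ Ideal.mul_mem_mul (Ideal.pow_mem_pow hx.1 n) ht
  have hdvd := mem_colonPow.1 h _ hmem
  rw [← mul_assoc, ← pow_succ', pow_succ x (n + 1),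
    mul_dvd_mul_iff_left (pow_ne_zero _ (hx.ne_zero hm))] at hdvd
  exact Ideal.mem_span_singleton.2 hdvd

variable {V : Type*} [CommRing V] [IsDomain V] [IsDiscreteValuationRing V] [Algebra R V]
  [FaithfulSMul R V] {a b : R}

theorem IsMinimalReduction.lengthQuot_colonPow (hx : IsMinimalReduction (maximalIdeal R) x)
    (hm : maximalIdeal R ≠ ⊥)
    (h1 : lengthQuot (maximalIdeal R ^ 2) (Ideal.span {x} * maximalIdeal R) = 1)
    (h : IsExtremalPair V (maximalIdeal R) x a b) (n : ℕ) :
    lengthQuot (colonPow (maximalIdeal R) x 1) (colonPow (maximalIdeal R) x (n + 2)) = 1 := by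
  have hx0 := hx.ne_zero hm
  have hne := not_sq_le_of_lengthQuot_eq_one h1
  have hJm := hx.colonPow_one_le hm hne
  refine le_antisymm ?_ (Order.one_le_iff_ne_zero.2 fun h0 => hx.notMem_colonPow hm hne n
    (lengthQuot_eq_zero_iff.1 h0 (span_le_colonPow_one _ x (Ideal.mem_span_singleton_self x))))
  -- multiplication by `ab` maps `(x : m)` to `x m²`, and only `colonPow m x (n + 2)` into `x² m`
  rw [← h1, ← lengthQuot_span_mul (mem_nonZeroDivisors_of_ne_zero hx0) (maximalIdeal R ^ 2)]
  refine lengthQuot_le_of_comap_inf_le (LinearMap.mulLeft R (a * b)) ?_ ?_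
  · rintro _ ⟨y, hy, rfl⟩
    obtain ⟨u, hu, huy⟩ := Ideal.mem_span_singleton_mul.1 <| hx.sq_inf_span_le hm
      ⟨mul_mem_sq (hJm hy) h.right_mem,
        Ideal.mem_span_singleton.2 (mem_colonPow_one.1 hy b h.right_mem)⟩
    refine Ideal.mem_span_singleton_mul.2 ⟨a * u, mul_mem_sq h.left_mem hu, ?_⟩
    rw [LinearMap.mulLeft_apply]
    linear_combination a * huy
  · rintro y ⟨hyab, hy⟩
    obtain ⟨w, hw, hwy⟩ := Ideal.mem_span_singleton_mul.1 (Submodule.mem_comap.1 hyab)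
    obtain ⟨z, hz, rfl⟩ := Ideal.mem_span_singleton_mul.1 hw
    refine h.mem_colonPow h1 hx.1 hx0 hy (hx.ord_le hm (hJm hy)) hz ?_ (n + 1)
    rw [LinearMap.mulLeft_apply] at hwy
    linear_combination -hwy

theorem IsMinimalReduction.lengthQuot_colonPow_pow [Ring.KrullDimLE 1 R]
    (hx : IsMinimalReduction (maximalIdeal R) x) (hm : maximalIdeal R ≠ ⊥)
    (h1 : lengthQuot (maximalIdeal R ^ 2) (Ideal.span {x} * maximalIdeal R) = 1)
    (h : IsExtremalPair V (maximalIdeal R) x a b) {n : ℕ}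
    (hn : reductionExponent (maximalIdeal R) x = n + 2) :
    lengthQuot (colonPow (maximalIdeal R) x (n + 2)) (maximalIdeal R ^ (n + 2)) + (n + 1) =
      lengthQuot (colonPow (maximalIdeal R) x 1) (Ideal.span {x}) +
        n * lengthQuot ⊤ (Ideal.span {x}) := by
  have hx0 := hx.ne_zero hm
  have hxr : x ∈ nonZeroDivisors R := mem_nonZeroDivisors_of_ne_zero hx0
  have htop : lengthQuot ⊤ (maximalIdeal R) = 1 :=
    (lengthQuot_eq_one_iff le_top).2 (covBy_top_iff.2 (maximalIdeal.isMaximal R).out)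
  have hfin : lengthQuot ⊤ (colonPow (maximalIdeal R) x 1) ≠ ⊤ := lengthQuot_ne_top hxr ⊤
    (span_le_colonPow_one _ x (Ideal.mem_span_singleton_self x))
  have hspan := lengthQuot_add (span_le_colonPow_one (maximalIdeal R) x) le_top
  have hpow := lengthQuot_top_pow h1 hxr hx.1 (n := n + 1) hn.ge
  rw [htop, lengthQuot_add (hn ▸ hx.pow_le_colonPow) le_top,
    lengthQuot_add (colonPow_le_colonPow_one hx.1 hx0 (n + 1)) le_top,
    hx.lengthQuot_colonPow hm h1 h n] at hpow
  generalize lengthQuot ⊤ (Ideal.span {x}) = e at *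
  generalize lengthQuot ⊤ (colonPow (maximalIdeal R) x 1) = t at *
  generalize lengthQuot (colonPow (maximalIdeal R) x 1) (Ideal.span {x}) = r at *
  push_cast at hpow
  have hfin' : 1 + t ≠ ⊤ := WithTop.add_ne_top.2 ⟨ENat.one_ne_top, hfin⟩
  refine ENat.add_left_injective_of_ne_top hfin' ?_
  beta_reduce
  rw [add_right_comm, hpow, add_one_mul, hspan]
  ring

theorem IsMinimalReduction.toNat_lengthQuot_colonPow_pow [Ring.KrullDimLE 1 R]
    (hx : IsMinimalReduction (maximalIdeal R) x) (hm : maximalIdeal R ≠ ⊥)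
    (h1 : lengthQuot (maximalIdeal R ^ 2) (Ideal.span {x} * maximalIdeal R) = 1)
    (h : IsExtremalPair V (maximalIdeal R) x a b) {ν : ℕ}
    (hν : reductionExponent (maximalIdeal R) x = ν) :
    ((lengthQuot (colonPow (maximalIdeal R) x ν) (maximalIdeal R ^ ν)).toNat : ℤ) =
      (lengthQuot (colonPow (maximalIdeal R) x 1) (Ideal.span {x})).toNat - 1 +
        ((lengthQuot ⊤ (Ideal.span {x})).toNat - 1) * (ν - 2) := by
  have hxr : x ∈ nonZeroDivisors R := mem_nonZeroDivisors_of_ne_zero (hx.ne_zero hm)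
  have hxs := Ideal.mem_span_singleton_self x
  have hν2 := hx.two_le_reductionExponent (not_sq_le_of_lengthQuot_eq_one h1)
  obtain ⟨n, rfl⟩ := Nat.exists_eq_add_of_le' (hν ▸ hν2)
  have hlen := hx.lengthQuot_colonPow_pow hm h1 h hν
  lift lengthQuot ⊤ (Ideal.span {x}) to ℕ using lengthQuot_ne_top hxr ⊤ hxs with e
  lift lengthQuot (colonPow (maximalIdeal R) x 1) (Ideal.span {x}) to ℕ using
    lengthQuot_ne_top hxr _ hxs with r
  lift lengthQuot (colonPow (maximalIdeal R) x (n + 2)) (maximalIdeal R ^ (n + 2)) to ℕ using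
    lengthQuot_ne_top (pow_mem hxr _) _ (Ideal.pow_mem_pow hx.1 _) with l
  norm_cast at hlen
  zify at hlen
  push_cast [ENat.toNat_natCast]
  linear_combination hlen

end Local

section Fractional

variable {R K : Type*} [CommRing R] [Field K] [Algebra R K]

theorem map_mulLeft_inK (x : R) (I : Ideal R) :
    (inK K I).map (LinearMap.mulLeft R (algebraMap R K x)) = inK K (Ideal.span {x} * I) := by
  ext z
  rw [inK, inK, IsLocalization.coeSubmodule_mul, IsLocalization.coeSubmodule_span_singleton,
    Submodule.mem_span_singleton_mul]
  rfl

variable [IsFractionRing R K] {I : Ideal R} {x : R}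

theorem lengthQuot_inK (A B : Ideal R) : lengthQuot (inK K A) (inK K B) = lengthQuot A B :=
  lengthQuot_map (f := Algebra.linearMap R K) (IsFractionRing.injective R K) A B

theorem mul_mem_inK_span_mul_iff (hx0 : x ≠ 0) {z : K} :
    algebraMap R K x * z ∈ inK K (Ideal.span {x} * I) ↔ z ∈ inK K I := by
  have hxK : algebraMap R K x ≠ 0 := by simpa using hx0
  rw [← map_mulLeft_inK]
  exact (mul_right_injective₀ hxK).mem_set_image

theorem IsMinimalReduction.mem_blowUp_iff (hx : IsMinimalReduction I x) (hx0 : x ≠ 0) {z : K} :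
    z ∈ blowUp K I ↔
      algebraMap R K (x ^ reductionExponent I x) * z ∈ inK K (I ^ reductionExponent I x) := by
  have : IsDomain R := (IsFractionRing.injective R K).isDomain
  set ν := reductionExponent I x
  have hpow (n : ℕ) : algebraMap R K (x ^ n) ∈ inK K (I ^ n) :=
    Submodule.mem_map_of_mem (Ideal.pow_mem_pow hx.1 n)
  refine Set.mem_iUnion.trans ⟨fun ⟨k, hk⟩ => ?_, fun h => ⟨ν, ?_⟩⟩
  · have hz : z ∈ inK K (I ^ (ν + k)) / inK K (I ^ (ν + k)) :=
      colon_mono K I (Nat.le_add_left k ν) hk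
    have hzx := Submodule.mem_div_iff_forall_mul_mem.1 hz _ (hpow (ν + k))
    rw [hx.pow_add_eq] at hzx
    rw [← mul_mem_inK_span_mul_iff (pow_ne_zero k hx0)]
    convert hzx using 1
    rw [pow_add, map_mul]
    ring
  · refine Submodule.mem_div_iff_forall_mul_mem.2 fun y hy => ?_
    rw [← mul_mem_inK_span_mul_iff (pow_ne_zero ν hx0), ← hx.pow_add_eq, pow_add, inK,
      IsLocalization.coeSubmodule_mul, ← mul_assoc]
    exact Submodule.mul_mem_mul h hy

theorem mem_inK_colon_iff (hx : x ∈ I) (hx0 : x ≠ 0) {y : K} :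
    y ∈ inK K ((Ideal.span {x}).colon (I : Set R)) ↔
      ∀ z : K, algebraMap R K x * z ∈ inK K I → y * z ∈ (1 : Submodule R K) := by
  have hxK : algebraMap R K x ≠ 0 := by simpa using hx0
  simp only [IsLocalization.mem_coeSubmodule, Submodule.mem_colon, SetLike.mem_coe, smul_eq_mul,
    Ideal.mem_span_singleton, Submodule.mem_one]
  constructor
  · rintro ⟨r, hr, rfl⟩ z ⟨t, ht, htz⟩
    obtain ⟨s, hs⟩ := hr t ht
    refine ⟨s, mul_left_cancel₀ hxK ?_⟩
    rw [mul_left_comm, ← htz, ← map_mul, ← map_mul, hs]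
  · intro h
    obtain ⟨r, hr⟩ := h 1 ⟨x, hx, (mul_one _).symm⟩
    rw [mul_one] at hr
    refine ⟨r, fun t ht => ?_, hr⟩
    obtain ⟨s, hs⟩ := h (algebraMap R K t / algebraMap R K x) ⟨t, ht, (mul_div_cancel₀ _ hxK).symm⟩
    refine ⟨s, IsFractionRing.injective R K ?_⟩
    rw [map_mul, map_mul, hs, hr]
    field_simp

theorem IsMinimalReduction.inK_colonPow (hx : IsMinimalReduction I x) (hx0 : x ≠ 0) :
    inK K (colonPow I x (reductionExponent I x)) = 1 / blowUp K I := by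
  have : IsDomain R := (IsFractionRing.injective R K).isDomain
  ext y
  rw [colonPow, mem_inK_colon_iff (Ideal.pow_mem_pow hx.1 _) (pow_ne_zero _ hx0),
    Submodule.mem_div_iff_forall_mul_mem]
  simp only [hx.mem_blowUp_iff hx0]

theorem map_mulLeft_one_div (hx : x ∈ I) (hx0 : x ≠ 0) :
    (1 / inK K I).map (LinearMap.mulLeft R (algebraMap R K x)) = inK K (colonPow I x 1) := by
  have hxK : algebraMap R K x ≠ 0 := by simpa using hx0
  ext y
  obtain ⟨u, rfl⟩ := mul_left_surjective₀ hxK y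
  rw [colonPow, pow_one, pow_one, mem_inK_colon_iff hx hx0]
  refine ((mul_right_injective₀ hxK).mem_set_image (s := (1 / inK K I : Submodule R K))).trans ?_
  refine Submodule.mem_div_iff_forall_mul_mem.trans ?_
  refine ((mul_left_surjective₀ hxK).forall (p := fun w => w ∈ inK K I → u * w ∈ 1)).trans ?_
  simp only [mul_assoc, mul_left_comm]

theorem lengthQuot_one_div (hx : x ∈ I) (hx0 : x ≠ 0) :
    lengthQuot ((1 : Submodule R K) / inK K I) 1 =
      lengthQuot (colonPow I x 1) (Ideal.span {x}) := by
  have hinj : Function.Injective (LinearMap.mulLeft R (algebraMap R K x)) :=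
    mul_right_injective₀ (by simpa using hx0)
  have hone : inK K (⊤ : Ideal R) = 1 := IsLocalization.coeSubmodule_top K
  rw [← lengthQuot_map hinj, map_mulLeft_one_div hx hx0, ← hone, map_mulLeft_inK, Ideal.mul_top,
    lengthQuot_inK]

theorem exists_conductor (A : Subalgebra R K) [Module.Finite R A] :
    ∃ f : R, f ≠ 0 ∧ ∀ v : A, ∃ r : R, algebraMap R A r = f • v := by
  have : IsDomain R := (IsFractionRing.injective R K).isDomain
  obtain ⟨f, hf0, hf⟩ := FractionalIdeal.isFractional_of_fg (S := nonZeroDivisors R)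
    (I := Subalgebra.toSubmodule A) (Module.Finite.iff_fg.1 ‹_›)
  refine ⟨f, nonZeroDivisors.ne_zero hf0, fun v => ?_⟩
  obtain ⟨r, hr⟩ := hf v v.2
  exact ⟨r, Subtype.ext hr⟩

end Fractional

end BlowUp

open BlowUp in
theorem theorem6p6_general {R K : Type*} [CommRing R] [IsDomain R] [IsLocalRing R]
    [IsNoetherianRing R] (hdim : ringKrullDim R = 1) [Field K] [Algebra R K] [IsFractionRing R K]
    [Module.Finite R (integralClosure R K)] [IsDiscreteValuationRing (integralClosure R K)]
    (hres : Function.Surjective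
      ((residue (integralClosure R K)).comp (algebraMap R (integralClosure R K))))
    (x : R) (hx : IsMinimalReduction (maximalIdeal R) x)
    (he : BlowUp.multiplicity (maximalIdeal R) = (embDim R : ℤ) + 1) :
    inK K (maximalIdeal R ^ reductionExponent (maximalIdeal R) x) ≤
      (1 : Submodule R K) / blowUp K (maximalIdeal R) ∧
    ∃ l : ℕ,
      lengthQuot ((1 : Submodule R K) / blowUp K (maximalIdeal R))
        (inK K (maximalIdeal R ^ reductionExponent (maximalIdeal R) x)) = l ∧
      (l : ℤ) = (cmType R K : ℤ) - 1 + (BlowUp.multiplicity (maximalIdeal R) - 1) *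
        ((reductionExponent (maximalIdeal R) x : ℤ) - 2) := by
  have : Ring.KrullDimLE 1 R := Ring.krullDimLE_iff.2 hdim.le
  have hm : maximalIdeal R ≠ ⊥ := fun h => zero_ne_one <|
    (ringKrullDim_eq_zero_of_isField (isField_iff_maximalIdeal_eq.2 h)).symm.trans hdim
  have hx0 := hx.ne_zero hm
  have hxr : x ∈ nonZeroDivisors R := mem_nonZeroDivisors_of_ne_zero hx0
  have h1 := hx.lengthQuot_sq_eq_one hxr (by rw [he, embDim, hilbertFun, pow_one])
  obtain ⟨a, b, hab⟩ :=
    exists_isExtremalPair (exists_conductor (integralClosure R K)) hres hm hx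
      (not_sq_le_of_lengthQuot_eq_one h1)
  rw [← hx.inK_colonPow hx0, lengthQuot_inK, hx.multiplicity_eq hxr, cmType,
    lengthQuot_one_div hx.1 hx0]
  refine ⟨IsLocalization.coeSubmodule_mono K hx.pow_le_colonPow, _, ?_,
    hx.toNat_lengthQuot_colonPow_pow hm h1 hab rfl⟩
  exact (ENat.natCast_toNat
    (lengthQuot_ne_top (pow_mem hxr _) _ (Ideal.pow_mem_pow hx.1 _))).symm

theorem theorem6p6 {R K : Type*} [CommRing R] [IsDomain R] [IsLocalRing R] [IsNoetherianRing R]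
    (hdim : ringKrullDim R = 1) [Infinite (IsLocalRing.ResidueField R)]
    [Field K] [Algebra R K] [IsFractionRing R K]
    [Module.Finite R (integralClosure R K)]
    [IsDiscreteValuationRing (integralClosure R K)]
    (hres : Function.Surjective
      ((IsLocalRing.residue (integralClosure R K)).comp (algebraMap R (integralClosure R K))))
    (x : R) (hx : BlowUp.IsMinimalReduction (IsLocalRing.maximalIdeal R) x)
    (he : BlowUp.multiplicity (IsLocalRing.maximalIdeal R) = (BlowUp.embDim R : ℤ) + 1) :
    BlowUp.inK K (IsLocalRing.maximalIdeal R ^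
        BlowUp.reductionExponent (IsLocalRing.maximalIdeal R) x) ≤
      (1 : Submodule R K) / BlowUp.blowUp K (IsLocalRing.maximalIdeal R) ∧
    ∃ l : ℕ,
      BlowUp.lengthQuot ((1 : Submodule R K) / BlowUp.blowUp K (IsLocalRing.maximalIdeal R))
        (BlowUp.inK K (IsLocalRing.maximalIdeal R ^
          BlowUp.reductionExponent (IsLocalRing.maximalIdeal R) x)) = l ∧
      (l : ℤ) = (BlowUp.cmType R K : ℤ) - 1 +
        (BlowUp.multiplicity (IsLocalRing.maximalIdeal R) - 1) *
          ((BlowUp.reductionExponent (IsLocalRing.maximalIdeal R) x : ℤ) - 2) := by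
  exact theorem6p6_general hdim hres x hx he
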